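/- Let $(\mathfrak g,[\cdot,\cdot])$ be a finite-dimensional real Lie algebra. A linear map $R:\mathfrak g\to\mathfrak g$ is called a modified $r$-matrix if $$[R(x),R(y)]=R\big([R(x),y]+[x,R(y)]\big)-[x,y]\qquad\text{for all }x,y\in\mathfrak g .$$ For a modified $r$-matrix $R$, put $[x,y]_R=[R(x),y]+[x,R(y)]$ (a Lie bracket on $\mathfrak g$) and $\rho(x)y=[R(x),y]-R([x,y])$ (a representation of $(\mathfrak g,[\cdot,\cdot]_R)$ on the vector space $\mathfrak g$). Let $H^2(R)=Z^2(R)/B^2(R)$, where, with the Chevalley–Eilenberg coboundary of $(\mathfrak g,[\cdot,\cdot]_R)$ with coefficients in $(\mathfrak g,\rho)$ on $C^1(R)=\mathfrak g$, $C^2(R)=\mathrm{Hom}(\mathfrak g,\mathfrak g)$, $C^3(R)=\mathrm{Hom}(\wedge^2\mathfrak g,\mathfrak g)$, $$Z^2(R)=\{f\in\mathrm{Hom}(\mathfrak g,\mathfrak g): \rho(x)f(y)-\rho(y)f(x)-f([x,y]_R)=0\ \ \forall x,y\in\mathfrak g\},\qquad B^2(R)=\{x\mapsto\rho(x)a : a\in\mathfrak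 g\}.$$ Let $\mathrm{InnAut}(\mathfrak g)$ be the group of inner automorphisms of $\mathfrak g$, i.e. the subgroup of $GL(\mathfrak g)$ generated by all $\exp(\mathrm{ad}_x)$, $x\in\mathfrak g$, with its structure of a connected (immersed) Lie subgroup of $GL(\mathfrak g)$ with Lie algebra $\mathrm{ad}(\mathfrak g)$. It acts on $\mathrm{Hom}(\mathfrak g,\mathfrak g)$ by $A\cdot f=AfA^{-1}$. **Theorem.** Let $R$ be a modified $r$-matrix on $\mathfrak g$. If $H^2(R)=0$, then there exist an open neighborhood $U\subset\mathrm{Hom}(\mathfrak g,\mathfrak g)$ of $R$ and a smooth map $p:U\to\mathrm{InnAut}(\mathfrak g)$ such that $p(R')\cdot R=R'$ for every modified $r$-matrix $R'\in U$. -/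

import Mathlib

open scoped ContDiff

noncomputable section

/-! ## The canonical topology and smooth structure of a finite-dimensional real vector space -/

section VectorSpaces

variable {V W : Type*} [AddCommGroup V] [Module ℝ V] [AddCommGroup W] [Module ℝ W]

/-- `U` is open in the canonical topology of the real vector space `V`. For finite-dimensional `V`
the module topology is the Euclidean topology, i.e. the topology of any norm. -/
def IsOpenInVS (U : Set V) : Prop := @IsOpen V (moduleTopology ℝ V) U

/-- `f : V → W` is smooth on the set `U`: it is smooth when written in linear coordinates of the
source and of the target. Changes of linear coordinates are smooth, so the choice of bases is
irrelevant. -/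
def SmoothOnVS [FiniteDimensional ℝ V] [FiniteDimensional ℝ W] (f : V → W) (U : Set V) : Prop :=
  ContDiffOn ℝ ∞
    (fun c : Fin (Module.finrank ℝ V) → ℝ =>
      (Module.finBasis ℝ W).equivFun (f ((Module.finBasis ℝ V).equivFun.symm c)))
    ((Module.finBasis ℝ V).equivFun.symm ⁻¹' U)

/-- The exponential `exp A = ∑ Aⁿ / n!` of an endomorphism of a finite-dimensional real vector
space, the series being summed in the canonical topology of `End V`. -/
def endExp [FiniteDimensional ℝ V] (A : Module.End ℝ V) : Module.End ℝ V :=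
  letI : TopologicalSpace (Module.End ℝ V) := moduleTopology ℝ (Module.End ℝ V)
  haveI : IsModuleTopology ℝ (Module.End ℝ V) := ⟨rfl⟩
  haveI : IsTopologicalRing (Module.End ℝ V) :=
    IsModuleTopology.isTopologicalRing ℝ (Module.End ℝ V)
  NormedSpace.exp A

end VectorSpaces

namespace ModifiedRMatrix

section Cohomology

variable {g : Type*} [LieRing g] [LieAlgebra ℝ g]

/-- `R` is a modified `r`-matrix: `[R x, R y] = R ([R x, y] + [x, R y]) - [x, y]`. -/
def IsModified (R : g →ₗ[ℝ] g) : Prop :=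
  ∀ x y : g, ⁅R x, R y⁆ = R (⁅R x, y⁆ + ⁅x, R y⁆) - ⁅x, y⁆

/-- The bracket `[x, y]_R = [R x, y] + [x, R y]`. -/
def bracketR (R : g →ₗ[ℝ] g) (x y : g) : g := ⁅R x, y⁆ + ⁅x, R y⁆

/-- The action `ρ(x) y = [R x, y] - R [x, y]` of `(g, [·,·]_R)` on the vector space `g`. -/
def rho (R : g →ₗ[ℝ] g) (x y : g) : g := ⁅R x, y⁆ - R ⁅x, y⁆

/-- The Chevalley–Eilenberg coboundary `C¹(R) = g → C²(R) = Hom(g, g)`, `(d a)(x) = ρ(x) a`. -/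
def d₁ (R : g →ₗ[ℝ] g) : g →ₗ[ℝ] (g →ₗ[ℝ] g) where
  toFun a :=
    { toFun := fun x => rho R x a
      map_add' := by intro x y; simp only [rho, map_add, add_lie]; abel
      map_smul' := by intro c x; simp only [rho, map_smul, smul_lie, smul_sub, RingHom.id_apply] }
  map_add' := by
    intro a b; ext x
    simp only [rho, map_add, lie_add, LinearMap.coe_mk, AddHom.coe_mk, LinearMap.add_apply]; abel
  map_smul' := by
    intro c a; ext x
    simp only [rho, map_smul, lie_smul, LinearMap.coe_mk, AddHom.coe_mk, LinearMap.smul_apply,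
      smul_sub, RingHom.id_apply]

/-- The Chevalley–Eilenberg coboundary `C²(R) = Hom(g, g) → C³(R) = Hom(⋀² g, g)`,
`(d f)(x, y) = ρ(x) f(y) - ρ(y) f(x) - f([x, y]_R)`. Elements of `Hom(⋀² g, g)` are alternating
bilinear maps. -/
def d₂ (R : g →ₗ[ℝ] g) : (g →ₗ[ℝ] g) →ₗ[ℝ] LieModule.Cohomology.twoCochain ℝ g g where
  toFun f :=
    ⟨LinearMap.mk₂ ℝ (fun x y => rho R x (f y) - rho R y (f x) - f (bracketR R x y))
      (by intro x x' y; simp only [rho, bracketR, map_add, add_lie, lie_add]; abel)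
      (by intro c x y
          simp only [rho, bracketR, map_smul, map_add, smul_lie, lie_smul, smul_sub, smul_add])
      (by intro x y y'; simp only [rho, bracketR, map_add, add_lie, lie_add]; abel)
      (by intro c x y
          simp only [rho, bracketR, map_smul, map_add, smul_lie, lie_smul, smul_sub, smul_add]),
      by
        rw [LieModule.Cohomology.mem_twoCochain_iff]
        intro x
        have h : ⁅R x, x⁆ + ⁅x, R x⁆ = 0 := by rw [← lie_skew x (R x)]; abel
        rw [LinearMap.mk₂_apply, bracketR, h, map_zero, sub_self, sub_zero]⟩
  map_add' := by
    intro f f'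
    apply Subtype.ext
    ext x y
    simp only [rho, map_add, lie_add, LinearMap.mk₂_apply, LinearMap.add_apply,
      Submodule.coe_add]
    abel
  map_smul' := by
    intro c f
    apply Subtype.ext
    ext x y
    simp only [rho, map_smul, lie_smul, LinearMap.mk₂_apply, LinearMap.smul_apply, smul_sub,
      Submodule.coe_smul, RingHom.id_apply]

/-- The 2-cocycles of `R`. -/
def Z2 (R : g →ₗ[ℝ] g) : Submodule ℝ (g →ₗ[ℝ] g) := LinearMap.ker (d₂ R)

/-- The 2-coboundaries of `R`. -/
def B2 (R : g →ₗ[ℝ] g) : Submodule ℝ (g →ₗ[ℝ] g) := LinearMap.range (d₁ R)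

/-- `d ∘ d = 0` in the degree that matters: for a modified `r`-matrix, coboundaries are cocycles. -/
theorem B2_le_Z2 {R : g →ₗ[ℝ] g} (hR : IsModified R) : B2 R ≤ Z2 R := by
  rintro _ ⟨a, rfl⟩
  refine LinearMap.mem_ker.2 (Subtype.ext ?_)
  ext x y
  have h1 := hR x ⁅y, a⁆
  have h2 := hR y ⁅x, a⁆
  have h3 : R (⁅R x, y⁆ + ⁅x, R y⁆) = ⁅R x, R y⁆ + ⁅x, y⁆ := by rw [hR x y]; abel
  change rho R x (rho R y a) - rho R y (rho R x a) - rho R (bracketR R x y) a = 0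
  simp only [rho, bracketR, lie_sub, h1, h2, h3, map_add, map_sub, add_lie, lie_lie]
  abel

/-- The second cohomology `H²(R) = Z²(R) / B²(R)` of a modified `r`-matrix `R`. -/
abbrev H2 (R : g →ₗ[ℝ] g) : Type _ := Z2 R ⧸ (B2 R).submoduleOf (Z2 R)

end Cohomology

section InnerAutomorphisms

variable (g : Type*) [LieRing g] [LieAlgebra ℝ g] [FiniteDimensional ℝ g]

/-- The group `InnAut(g)` of inner automorphisms: the subgroup of `GL(g)` generated by the
automorphisms `exp(ad x)`, `x ∈ g`. -/
def InnAut : Subgroup (g ≃ₗ[ℝ] g) :=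
  Subgroup.closure {A | ∃ x : g, (A : Module.End ℝ g) = endExp (LieAlgebra.ad ℝ g x)}

variable {g}

/-- The action `A · f = A f A⁻¹` of `InnAut(g)` on `Hom(g, g)`. -/
def act (A : InnAut g) (f : g →ₗ[ℝ] g) : g →ₗ[ℝ] g :=
  (A : g ≃ₗ[ℝ] g).toLinearMap ∘ₗ f ∘ₗ (A : g ≃ₗ[ℝ] g).symm.toLinearMap

/-- `p` is smooth on `U` as a map into the Lie group `InnAut(g)`, i.e. for the smooth structure of
the connected immersed Lie subgroup of `GL(g)` with Lie algebra `InnDer(g) = ad(g)`, which can be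
finer than what is induced from `GL(g)`. Its charts are the left translates `A exp(ad ·)` of
exponential coordinates, so `p` is smooth iff near every point of `U` it can be written as
`p(m) = A exp(ad ξ(m))` with `A ∈ InnAut(g)` fixed and `ξ` a smooth map into `g`. -/
def SmoothIntoInnAut {V : Type*} [AddCommGroup V] [Module ℝ V] [FiniteDimensional ℝ V]
    (p : V → InnAut g) (U : Set V) : Prop :=
  ∀ m₀ ∈ U, ∃ N : Set V, IsOpenInVS N ∧ m₀ ∈ N ∧ N ⊆ U ∧
    ∃ (A : InnAut g) (ξ : V → g), SmoothOnVS ξ N ∧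
      ∀ m ∈ N, ((p m : g ≃ₗ[ℝ] g) : Module.End ℝ g) =
        ((A : g ≃ₗ[ℝ] g) : Module.End ℝ g) * endExp (LieAlgebra.ad ℝ g (ξ m))

end InnerAutomorphisms

end ModifiedRMatrix

end

/-! Modified `r`-matrices are the zeros of a quadratic map on `Hom(g, g)` whose linearization at `R`
is `d₂ R`. The orbit of `R` has tangent space `B2 R`. Choose a projection `π` with kernel `B2 R`.
The inverse function theorem writes every `R'` near `R` as `exp(ad a) (R + c) exp(-ad a)`, with `a`
smooth in `R'` and `π c = c` (`exists_conj_slice`). Inner automorphisms preserve the equation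
(`exp_apply_bilinear`), so if `R'` solves it, so does `R + c`. Hence `D c + q c c = 0`, where `D` is
the linearization. As `H2 R = 0`, `D` is injective on the image of `π`, so `c` is bounded by a
multiple of `‖c‖²` and vanishes when small (`eventually_eq_zero_of_add_quadratic_eq_zero`). -/

open NormedSpace Filter Topology

/-! ### Local rigidity in a normed space -/

section Auxiliary

/-- A linear map between vector spaces has a generalized inverse. -/
theorem LinearMap.exists_generalizedInverse {K V W : Type*} [Field K] [AddCommGroup V] [Module K V]
    [AddCommGroup W] [Module K W] (T : V →ₗ[K] W) : ∃ σ : W →ₗ[K] V, T ∘ₗ σ ∘ₗ T = T := by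
  obtain ⟨s, hs⟩ := T.rangeRestrict.exists_rightInverse_of_surjective T.range_rangeRestrict
  obtain ⟨P, hP⟩ := (LinearMap.range T).subtype.exists_leftInverse_of_injective
    (Submodule.ker_subtype _)
  refine ⟨s ∘ₗ P, LinearMap.ext fun v => ?_⟩
  have h1 : P (T v) = T.rangeRestrict v := LinearMap.congr_fun hP (T.rangeRestrict v)
  have h2 := LinearMap.congr_fun hs (T.rangeRestrict v)
  have h3 := congrArg Subtype.val h2
  simpa [h1] using h3

/-- If `D` is injective on the image of an idempotent `π`, then near `0` the equation
`D c + q c c = 0` with `π c = c` has only the zero solution. -/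
theorem eventually_eq_zero_of_add_quadratic_eq_zero {E W : Type*} [NormedAddCommGroup E]
    [NormedSpace ℝ E] [FiniteDimensional ℝ E] [AddCommGroup W] [Module ℝ W]
    [FiniteDimensional ℝ W] (D : E →ₗ[ℝ] W) (q : E →ₗ[ℝ] E →ₗ[ℝ] W) (π : E →ₗ[ℝ] E)
    (h : ∀ c, π c = c → D c = 0 → c = 0) :
    ∀ᶠ c in 𝓝 (0 : E), π c = c → D c + q c c = 0 → c = 0 := by
  let e := (Module.finBasis ℝ W).equivFun
  let Q : E →L[ℝ] E →L[ℝ] (Fin (Module.finrank ℝ W) → ℝ) := LinearMap.toContinuousLinearMap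
    ((LinearMap.toContinuousLinearMap : _ ≃ₗ[ℝ] _).toLinearMap ∘ₗ (q.compr₂ e.toLinearMap))
  have hQ : ∀ c, Q c c = e (q c c) := fun c => rfl
  -- Pairing `D` with `id - π` turns the constraint `π c = c` into a second linear equation, so the
  -- pair is injective on all of `E` and bounded below.
  have hinj : LinearMap.ker ((e.toLinearMap ∘ₗ D).prod (LinearMap.id - π)) = ⊥ := by
    rw [LinearMap.ker_eq_bot']
    intro c hc
    have h1 : e (D c) = 0 := congrArg Prod.fst hc
    have h2 : c - π c = 0 := congrArg Prod.snd hc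
    exact h c (sub_eq_zero.1 h2).symm (e.map_eq_zero_iff.1 h1)
  obtain ⟨K, hK, hlip⟩ := LinearMap.exists_antilipschitzWith _ hinj
  have hsmall : ∀ᶠ c in 𝓝 (0 : E), K * (‖Q‖ * ‖c‖) < 1 := by
    have : ContinuousAt (fun c : E => (K : ℝ) * (‖Q‖ * ‖c‖)) 0 := by fun_prop
    exact this.eventually (gt_mem_nhds (by simp))
  filter_upwards [hsmall] with c hc hπ hD
  have h1 : ‖c‖ ≤ K * ‖e (D c)‖ := by
    have h2 := hlip.le_mul_dist c 0
    simpa [hπ, Prod.norm_def] using h2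
  have h2 : ‖e (D c)‖ ≤ ‖Q‖ * ‖c‖ * ‖c‖ := by
    rw [eq_neg_of_add_eq_zero_left hD, map_neg, norm_neg, ← hQ]
    exact Q.le_opNorm₂ c c
  have h3 : ‖c‖ ≤ K * (‖Q‖ * ‖c‖) * ‖c‖ := by
    refine h1.trans ((mul_le_mul_of_nonneg_left h2 K.2).trans_eq ?_)
    change (K : ℝ) * _ = _
    ring
  by_contra hne
  have := norm_pos_iff.2 hne
  nlinarith

variable {A : Type*} [NormedRing A] [NormedAlgebra ℝ A] [CompleteSpace A]

theorem NormedSpace.exp_mul_exp_neg (x : A) : exp x * exp (-x) = 1 := by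
  let _ : NormedAlgebra ℚ A := NormedAlgebra.restrictScalars ℚ ℝ A
  rw [← exp_add_of_commute (Commute.neg_right (Commute.refl x)), add_neg_cancel, exp_zero]

theorem NormedSpace.exp_neg_mul_exp (x : A) : exp (-x) * exp x = 1 := by
  simpa using exp_mul_exp_neg (-x)

theorem contDiff_normedSpace_exp : ContDiff ℝ ω (exp : A → A) :=
  contDiff_iff_contDiffAt.2 fun x => (exp_analytic (𝕂 := ℝ) x).contDiffAt

variable {V : Type*} [NormedAddCommGroup V] [NormedSpace ℝ V]

/-- A slice for the conjugation action of the elements `exp (M a)`: near `R`, every element is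
`exp (M a) (R + c) exp (- M a)` with `a` depending smoothly on it and `c` in a complement of the
tangent space of the orbit. -/
theorem exists_conj_slice [FiniteDimensional ℝ A] [FiniteDimensional ℝ V] (M : V →L[ℝ] A) (R : A)
    (T : V →ₗ[ℝ] A) (hT : ∀ a, T a = M a * R - R * M a) (σ : A →ₗ[ℝ] V) (P : A → Prop)
    (hP : ∀ᶠ f in 𝓝 (0 : A), P f) :
    ∃ G : A → A, ∃ U : Set A, IsOpen U ∧ R ∈ U ∧ ContDiffOn ℝ ∞ G U ∧
      ∀ f ∈ U, P (G f) ∧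
        exp (M (σ (G f))) * (R + (G f - T (σ (G f)))) * exp (-M (σ (G f))) = f := by
  let N : A →L[ℝ] A := M ∘L LinearMap.toContinuousLinearMap σ
  let Q : A →L[ℝ] A := ContinuousLinearMap.id ℝ A - LinearMap.toContinuousLinearMap (T ∘ₗ σ)
  let Φ : A → A := fun f => exp (N f) * (R + Q f) * exp (-N f)
  have hΦ0 : Φ 0 = R := by simp [Φ]
  have hexp : ContDiff ℝ ω (exp : A → A) := contDiff_normedSpace_exp
  have hΦ : ContDiff ℝ ω Φ :=
    ((hexp.comp N.contDiff).mul (contDiff_const.add Q.contDiff)).mul (hexp.comp N.contDiff.neg)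
  have h1 : HasFDerivAt (fun f : A => exp (N f)) N 0 := by
    have h := hasFDerivAt_exp_zero (𝕂 := ℝ) (𝔸 := A)
    rw [← map_zero N] at h
    exact h.comp (0 : A) N.hasFDerivAt
  have h2 : HasFDerivAt (fun f : A => exp (-N f)) (-N) 0 := by
    have h := hasFDerivAt_exp_zero (𝕂 := ℝ) (𝔸 := A)
    rw [← map_zero (-N)] at h
    exact h.comp (0 : A) (-N).hasFDerivAt
  -- The derivative at `0` is `f ↦ N f * R + (f - T (σ f)) - R * N f`; by `hT` the outer terms add
  -- up to `T (σ f)`, leaving the identity.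
  have h3 : HasFDerivAt Φ ((ContinuousLinearEquiv.refl ℝ A : A ≃L[ℝ] A) : A →L[ℝ] A) 0 := by
    have h := (h1.mul' (Q.hasFDerivAt.const_add R)).mul' h2
    refine h.congr_fderiv (ContinuousLinearMap.ext fun f => ?_)
    simp [Q, N, hT, exp_zero]
    abel
  have hG := hΦ.contDiffAt.to_localInverse h3 (by simp)
  have hG0 : hΦ.contDiffAt.localInverse h3 (by simp) R = 0 := by
    have := hΦ.contDiffAt.localInverse_apply_image h3 (by simp)
    rwa [hΦ0] at this
  have hright : ∀ᶠ f in 𝓝 R, Φ (hΦ.contDiffAt.localInverse h3 (by simp) f) = f := by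
    have := (hΦ.contDiffAt.hasStrictFDerivAt' h3 (by simp)).eventually_right_inverse
    rwa [hΦ0] at this
  rw [hΦ0] at hG
  set G := hΦ.contDiffAt.localInverse h3 (by simp)
  have hPG : ∀ᶠ f in 𝓝 R, P (G f) := by
    refine hG.continuousAt.eventually ?_
    rwa [hG0]
  -- Class `ω` at a point spreads to a neighborhood, which pointwise class `∞` need not do; hence
  -- the weakening to `∞` only at the end.
  obtain ⟨U, hU, hUo, hRU⟩ := eventually_nhds_iff.1
    ((hPG.and hright).and (hG.eventually (by simp)))
  exact ⟨G, U, hUo, hRU, fun f hf => ((hU f hf).2.of_le (by simp)).contDiffWithinAt, fun f hf =>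
    ⟨(hU f hf).1.1, (hU f hf).1.2⟩⟩

/-- The exponential of a derivation of a bilinear product is an automorphism. -/
theorem exp_apply_bilinear [CompleteSpace V] (β : V →L[ℝ] V →L[ℝ] V) (D : V →L[ℝ] V)
    (hD : ∀ y z, D (β y z) = β (D y) z + β y (D z)) (y z : V) :
    exp D (β y z) = β (exp D y) (exp D z) := by
  have he : ∀ (E : V →L[ℝ] V) (v : V) (t : ℝ),
      HasDerivAt (fun t : ℝ => exp (t • E) v) (E (exp (t • E) v)) t := fun E v t => by
    have := (hasDerivAt_exp_smul_const' (𝕂 := ℝ) E t).clm_apply (hasDerivAt_const t v)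
    simpa using this
  -- This curve is constant; comparing `t = 1` with `t = 0` gives the claim.
  have hF : ∀ t : ℝ, HasDerivAt
      (fun t : ℝ => exp (t • -D) (β (exp (t • D) y) (exp (t • D) z))) 0 t := fun t => by
    have hb := (β.hasFDerivAt.comp_hasDerivAt t (he D y t)).clm_apply (he D z t)
    have h := (hasDerivAt_exp_smul_const (𝕂 := ℝ) (-D) t).clm_apply hb
    refine h.congr_deriv ?_
    simp [hD]
  have hc := is_const_of_deriv_eq_zero (fun t => (hF t).differentiableAt)
    (fun t => (hF t).deriv) 1 0
  simp only [one_smul, zero_smul, exp_zero, one_apply_eq_self] at hc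
  rw [← hc, ← mul_apply_eq_comp, exp_mul_exp_neg, one_apply_eq_self]

/-- The bilinear map whose value at `(f, f)` is the quadratic part
`β (f x) (f y) - f (β (f x) y + β x (f y))` of the modified Yang-Baxter equation. -/
noncomputable def yangBaxterForm (β : V →L[ℝ] V →L[ℝ] V) :
    (V →L[ℝ] V) →ₗ[ℝ] (V →L[ℝ] V) →ₗ[ℝ] (V →ₗ[ℝ] V →ₗ[ℝ] V) :=
  LinearMap.mk₂ ℝ
    (fun f h => LinearMap.mk₂ ℝ (fun x y => β (f x) (h y) - f (β (h x) y + β x (h y)))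
      (by intros; simp; abel) (by intros; simp [smul_sub])
      (by intros; simp; abel) (by intros; simp [smul_sub]))
    (by intros; ext; simp; abel) (by intros; ext; simp [smul_sub])
    (by intros; ext; simp; abel) (by intros; ext; simp [smul_sub])

theorem yangBaxterForm_apply (β : V →L[ℝ] V →L[ℝ] V) (f h : V →L[ℝ] V) (x y : V) :
    yangBaxterForm β f h x y = β (f x) (h y) - f (β (h x) y + β x (h y)) := rfl

/-- Solutions of the modified Yang-Baxter equation near an infinitesimally rigid one are conjugate
to it by inner automorphisms depending smoothly on the solution. -/
theorem exists_contDiffOn_exp_conj_eq [FiniteDimensional ℝ V] (β : V →L[ℝ] V →L[ℝ] V)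
    (hβ : ∀ x y z, β x (β y z) = β (β x y) z + β y (β x z)) (R : V →L[ℝ] V)
    (hR : ∀ x y, β (R x) (R y) = R (β (R x) y + β x (R y)) - β x y)
    (hH : ∀ f : V →L[ℝ] V, (∀ x y, β (R x) (f y) + β (f x) (R y) =
      f (β (R x) y + β x (R y)) + R (β (f x) y + β x (f y))) →
      ∃ a, ∀ x, f x = β a (R x) - R (β a x)) :
    ∃ U : Set (V →L[ℝ] V), IsOpen U ∧ R ∈ U ∧ ∃ ξ : (V →L[ℝ] V) → V, ContDiffOn ℝ ∞ ξ U ∧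
      ∀ R' ∈ U, (∀ x y, β (R' x) (R' y) = R' (β (R' x) y + β x (R' y)) - β x y) →
        exp (β (ξ R')) * R * exp (-β (ξ R')) = R' := by
  have : CompleteSpace V := FiniteDimensional.complete ℝ V
  let q := yangBaxterForm β
  -- The polarization of `f ↦ q f f` at `R`: this is `d₂ R` in coordinates.
  let D := q R + q.flip R
  let T : V →ₗ[ℝ] V →L[ℝ] V :=
    (LinearMap.mulRight ℝ R - LinearMap.mulLeft ℝ R) ∘ₗ β.toLinearMap
  obtain ⟨σ, hσ⟩ := T.exists_generalizedInverse
  let π : (V →L[ℝ] V) →ₗ[ℝ] (V →L[ℝ] V) := LinearMap.id - T ∘ₗ σ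
  have hπT : ∀ a, π (T a) = 0 := fun a => by
    have := LinearMap.congr_fun hσ a
    simp only [LinearMap.comp_apply] at this
    simp [π, this]
  have hππ : ∀ f, π (π f) = π f := fun f => by
    have h : π f = f - T (σ f) := rfl
    conv_lhs => rw [h, map_sub, hπT, sub_zero]
  -- A cocycle is some `T a` by `hH`, and `π` kills the range of `T`.
  have hD : ∀ c, π c = c → D c = 0 → c = 0 := fun c hc hDc => by
    obtain ⟨a, ha⟩ := hH c fun x y => by
      have h := LinearMap.congr_fun (LinearMap.congr_fun hDc x) y
      simp only [D, q, LinearMap.add_apply, LinearMap.flip_apply, yangBaxterForm_apply,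
        LinearMap.zero_apply] at h
      rw [← sub_eq_zero, ← h]
      abel
    have hTa : c = T a := ContinuousLinearMap.ext ha
    rw [← hc, hTa, hπT]
  have hev := eventually_eq_zero_of_add_quadratic_eq_zero D q π hD
  have hπc : Tendsto π (𝓝 0) (𝓝 0) :=
    (LinearMap.continuous_of_finiteDimensional π).tendsto' 0 0 (map_zero π)
  obtain ⟨G, U, hU, hRU, hG, hGU⟩ :=
    exists_conj_slice β R T (fun a => rfl) σ _ (hπc.eventually hev)
  refine ⟨U, hU, hRU, σ ∘ G, (LinearMap.toContinuousLinearMap σ).contDiff.comp_contDiffOn hG, ?_⟩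
  intro R' hR' hmod
  obtain ⟨hP, hconj⟩ := hGU R' hR'
  change exp (β (σ (G R'))) * (R + π (G R')) * exp (-β (σ (G R'))) = R' at hconj
  set E := exp (β (σ (G R'))) with hE
  have hEβ : ∀ y z, E (β y z) = β (E y) (E z) := exp_apply_bilinear β _ (hβ _)
  set c := π (G R')
  have hR'E : ∀ x, R' (E x) = E ((R + c) x) := fun x => by
    have h : R' * E = E * (R + c) := by
      rw [← hconj, mul_assoc, hE, exp_neg_mul_exp, mul_one]
    exact DFunLike.congr_fun h x
  have hEinj : Function.Injective E := fun x y hxy => by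
    have h : ∀ v, exp (-β (σ (G R'))) (E v) = v :=
      DFunLike.congr_fun (exp_neg_mul_exp (β (σ (G R'))))
    rw [← h x, hxy, h]
  -- Since `R' * E = E * (R + c)` and `E` is an injective endomorphism of the bracket, the equation
  -- passes from `R'` to `R + c`.
  have hS : ∀ x y, β ((R + c) x) ((R + c) y) =
      (R + c) (β ((R + c) x) y + β x ((R + c) y)) - β x y := fun x y => by
    have h := hmod (E x) (E y)
    rw [hR'E, hR'E, ← hEβ, ← hEβ, ← hEβ, ← hEβ, ← map_add, hR'E, ← map_sub] at h
    exact hEinj h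
  -- Subtracting the equation of `R` from that of `R + c` cancels `β x y` and leaves `D c + q c c =
  -- 0`.
  have hc : c = 0 := by
    refine hP (hππ _) (LinearMap.ext₂ fun x y => ?_)
    have h1 := hS x y
    have h2 := hR x y
    simp only [add_apply, map_add] at h1 h2
    simp only [D, q, LinearMap.add_apply, LinearMap.flip_apply, yangBaxterForm_apply,
      LinearMap.zero_apply, map_add]
    rw [h2, ← sub_eq_zero] at h1
    rw [← h1]
    abel
  rw [hc, add_zero] at hconj
  exact hconj

end Auxiliary

/-! ### Passage to linear coordinates -/

section Coordinates

variable {V W : Type*} [AddCommGroup V] [Module ℝ V] [AddCommGroup W] [Module ℝ W]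
  [FiniteDimensional ℝ W]
  {E F : Type*} [NormedAddCommGroup E] [NormedSpace ℝ E] [NormedAddCommGroup F] [NormedSpace ℝ F]

theorem IsOpenInVS.preimage (e : V →ₗ[ℝ] E) {U : Set E} (hU : IsOpen U) :
    IsOpenInVS (e ⁻¹' U) := by
  let _ : TopologicalSpace V := moduleTopology ℝ V
  have : IsModuleTopology ℝ V := ⟨rfl⟩
  exact hU.preimage (IsModuleTopology.continuous_of_linearMap e)

variable [FiniteDimensional ℝ V]

theorem SmoothOnVS.comp_linearMap [FiniteDimensional ℝ F] (e : V →ₗ[ℝ] E) (e' : F →ₗ[ℝ] W)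
    {f : E → F} {U : Set E} (hf : ContDiffOn ℝ ∞ f U) :
    SmoothOnVS (fun v => e' (f (e v))) (e ⁻¹' U) := by
  have h1 : ContDiff ℝ ∞ (LinearMap.toContinuousLinearMap
    ((Module.finBasis ℝ W).equivFun.toLinearMap ∘ₗ e')) := ContinuousLinearMap.contDiff _
  have h2 : ContDiff ℝ ∞ (LinearMap.toContinuousLinearMap
    (e ∘ₗ (Module.finBasis ℝ V).equivFun.symm.toLinearMap)) := ContinuousLinearMap.contDiff _
  exact h1.comp_contDiffOn (hf.comp h2.contDiffOn fun c hc => hc)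

/-- An isomorphism from the algebra of endomorphisms to a normed algebra intertwines the
exponentials. -/
theorem map_endExp {A : Type*} [NormedRing A] [NormedAlgebra ℝ A]
    (ι : Module.End ℝ V ≃ₐ[ℝ] A) (f : Module.End ℝ V) : ι (endExp f) = exp (ι f) := by
  let _ : TopologicalSpace (Module.End ℝ V) := moduleTopology ℝ (Module.End ℝ V)
  have : IsModuleTopology ℝ (Module.End ℝ V) := ⟨rfl⟩
  have : IsTopologicalRing (Module.End ℝ V) :=
    IsModuleTopology.isTopologicalRing ℝ (Module.End ℝ V)
  have : FiniteDimensional ℝ A := ι.toLinearEquiv.finiteDimensional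
  have h1 : Continuous ι := IsModuleTopology.continuous_of_linearMap ι.toLinearMap
  have h2 : Continuous ι.symm := LinearMap.continuous_of_finiteDimensional ι.symm.toLinearMap
  have : T2Space (Module.End ℝ V) := T2Space.of_injective_continuous ι.injective h1
  change ι (exp f) = exp (ι f)
  rw [exp_eq_tsum ℝ, exp_eq_tsum ℝ]
  let e : Module.End ℝ V ≃L[ℝ] A := ⟨ι.toLinearEquiv, h1, h2⟩
  change e (∑' n : ℕ, _) = _
  rw [e.map_tsum]
  exact tsum_congr fun n => by
    change ι _ = _
    rw [map_smul, map_pow]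

/-- The algebra of endomorphisms in the coordinates of the chosen basis. -/
noncomputable def endCoord (V : Type*) [AddCommGroup V] [Module ℝ V] [FiniteDimensional ℝ V] :
    Module.End ℝ V ≃ₐ[ℝ]
      ((Fin (Module.finrank ℝ V) → ℝ) →L[ℝ] (Fin (Module.finrank ℝ V) → ℝ)) :=
  ((Module.finBasis ℝ V).equivFun.conjAlgEquiv ℝ).trans (Module.End.toContinuousLinearMap _)

theorem endCoord_apply (f : Module.End ℝ V) (v : Fin (Module.finrank ℝ V) → ℝ) :
    endCoord V f v =
      (Module.finBasis ℝ V).equivFun (f ((Module.finBasis ℝ V).equivFun.symm v)) := rfl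

theorem endExp_mul_endExp_neg (f : Module.End ℝ V) : endExp f * endExp (-f) = 1 :=
  (endCoord V).injective (by
    rw [map_mul, map_endExp, map_endExp, map_neg, exp_mul_exp_neg, map_one])

theorem endExp_neg_mul_endExp (f : Module.End ℝ V) : endExp (-f) * endExp f = 1 := by
  simpa using endExp_mul_endExp_neg (-f)

end Coordinates

/-! ### Cohomology, inner automorphisms and the theorem -/

namespace ModifiedRMatrix

variable {g : Type*} [LieRing g] [LieAlgebra ℝ g]

theorem exists_rho_eq_of_subsingleton_H2 {R : g →ₗ[ℝ] g} (hH : Subsingleton (H2 R))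
    (f : g →ₗ[ℝ] g) (hf : ∀ x y, rho R x (f y) - rho R y (f x) - f (bracketR R x y) = 0) :
    ∃ a, ∀ x, f x = rho R x a := by
  have hZ : f ∈ Z2 R := LinearMap.mem_ker.2 (Subtype.ext (LinearMap.ext₂ hf))
  have hle : (B2 R).submoduleOf (Z2 R) = ⊤ := Submodule.Quotient.subsingleton_iff.1 hH
  have hB : (⟨f, hZ⟩ : Z2 R) ∈ (B2 R).submoduleOf (Z2 R) := hle ▸ Submodule.mem_top
  obtain ⟨a, ha⟩ : f ∈ B2 R := hB
  exact ⟨a, fun x => by rw [← ha]; rfl⟩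

variable [FiniteDimensional ℝ g]

/-- The inner automorphism `exp (ad x)`. -/
noncomputable def expAd (x : g) : InnAut g :=
  ⟨LinearEquiv.ofLinearMap (endExp (LieAlgebra.ad ℝ g x)) (endExp (-LieAlgebra.ad ℝ g x))
    (endExp_mul_endExp_neg _) (endExp_neg_mul_endExp _),
    Subgroup.subset_closure ⟨x, rfl⟩⟩

theorem act_expAd (x : g) (f : g →ₗ[ℝ] g) : act (expAd x) f =
    endExp (LieAlgebra.ad ℝ g x) * f * endExp (-LieAlgebra.ad ℝ g x) := rfl

/-- A map `m ↦ exp (ad ξ(m))` with smooth `ξ` is smooth into the group of inner automorphisms. -/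
theorem smoothIntoInnAut_expAd {V : Type*} [AddCommGroup V] [Module ℝ V] [FiniteDimensional ℝ V]
    {ξ : V → g} {U : Set V} (hU : IsOpenInVS U) (hξ : SmoothOnVS ξ U) :
    SmoothIntoInnAut (fun m => expAd (ξ m)) U := fun _ hm =>
  ⟨U, hU, hm, subset_rfl, 1, ξ, hξ, fun _ _ => (one_mul _).symm⟩

end ModifiedRMatrix

open ModifiedRMatrix in
theorem mainTheorem4 {g : Type*} [LieRing g] [LieAlgebra ℝ g] [FiniteDimensional ℝ g]
    (R : g →ₗ[ℝ] g) (hR : ModifiedRMatrix.IsModified R)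
    (hH : Subsingleton (ModifiedRMatrix.H2 R)) :
    ∃ (U : Set (g →ₗ[ℝ] g)) (p : (g →ₗ[ℝ] g) → ModifiedRMatrix.InnAut g),
      IsOpenInVS U ∧ R ∈ U ∧ ModifiedRMatrix.SmoothIntoInnAut p U ∧
      ∀ R' ∈ U, ModifiedRMatrix.IsModified R' → ModifiedRMatrix.act (p R') R = R' := by
  let e := (Module.finBasis ℝ g).equivFun
  let ι := endCoord g
  have hι : ∀ (f : g →ₗ[ℝ] g) v, ι f v = e (f (e.symm v)) := endCoord_apply
  have hιs : ∀ f x, ι.symm f x = e.symm (f (e x)) := fun f x => by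
    obtain ⟨f, rfl⟩ := ι.surjective f
    rw [hι, ι.symm_apply_apply, e.symm_apply_apply, e.symm_apply_apply]
  -- The Lie bracket in coordinates; `β v` corresponds to `ad` of `e.symm v`, so exponentials match
  -- through `map_endExp`.
  let β : (Fin (Module.finrank ℝ g) → ℝ) →L[ℝ]
      (Fin (Module.finrank ℝ g) → ℝ) →L[ℝ] (Fin (Module.finrank ℝ g) → ℝ) :=
    LinearMap.toContinuousLinearMap
      (ι.toLinearMap ∘ₗ (LieAlgebra.ad ℝ g : g →ₗ[ℝ] Module.End ℝ g) ∘ₗ e.symm.toLinearMap)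
  have hβι : ∀ v, β v = ι (LieAlgebra.ad ℝ g (e.symm v)) := fun v => rfl
  have hβ : ∀ v w, β v w = e ⁅e.symm v, e.symm w⁆ := fun v w => by
    rw [hβι, hι, LieAlgebra.ad_apply]
  have hmod : ∀ f : g →ₗ[ℝ] g, IsModified f → ∀ v w,
      β (ι f v) (ι f w) = ι f (β (ι f v) w + β v (ι f w)) - β v w := fun f hf v w => by
    simp only [hβ, hι, e.symm_apply_apply, ← map_add, ← map_sub]
    rw [hf]
  obtain ⟨U, hU, hRU, ξ, hξ, h⟩ := exists_contDiffOn_exp_conj_eq β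
    (fun x y z => by simp only [hβ, e.symm_apply_apply, ← map_add]; rw [leibniz_lie])
    (ι R) (hmod R hR) fun f hf => by
      obtain ⟨a, ha⟩ := exists_rho_eq_of_subsingleton_H2 hH (ι.symm f) fun x y => by
        have h := congrArg e.symm (hf (e x) (e y))
        simp only [hβ, hι, e.symm_apply_apply, map_add] at h
        simp only [rho, bracketR, hιs, map_add]
        rw [← lie_skew (R y), ← lie_skew y, map_neg]
        rw [← sub_eq_zero] at h
        rw [← h]
        abel
      -- The sign appears because `rho R x a = -(⁅a, R x⁆ - R ⁅a, x⁆)`.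
      refine ⟨e (-a), fun v => ?_⟩
      have h := congrArg e (ha (e.symm v))
      rw [hιs, e.apply_symm_apply, e.apply_symm_apply] at h
      rw [h]
      simp only [rho, hβ, hι, e.symm_apply_apply]
      simp only [neg_lie, lie_skew, map_sub]
  have hUV : IsOpenInVS (ι ⁻¹' U) := IsOpenInVS.preimage ι.toLinearMap hU
  refine ⟨ι ⁻¹' U, fun f => expAd (e.symm (ξ (ι f))), hUV, hRU,
    smoothIntoInnAut_expAd hUV
      (SmoothOnVS.comp_linearMap ι.toLinearMap e.symm.toLinearMap hξ), fun R' hR' hm => ?_⟩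
  apply ι.injective
  rw [act_expAd, map_mul, map_mul, map_endExp, map_endExp, map_neg, ← hβι]
  exact h _ hR' (hmod R' hm)
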